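/- For integers $n,d\ge 0$ let $\Gamma_n^d$ be the set of $n\times n$ $(0,1)$-matrices in which every row has exactly $d$ entries equal to $1$, and these occupy $d$ consecutive columns (a contiguous, non-cyclic block). Let $1_{d\times d}$ be the all-ones $d\times d$ matrix, let $\oplus$ denote the direct sum of square matrices, and let $t\,1_{d\times d}$ denote the direct sum of $t$ copies of $1_{d\times d}$. A matrix contains $1_{d\times d}$ as a submatrix if there are $d$ distinct rows and $d$ distinct columns (not necessarily consecutive) at whose intersections all entries are $1$. For every $A\in\Gamma_a^d$ with $\operatorname{per}(A)>0$ there is $m(A)\in\mathbb N$ such that for every integer $t\ge 0$ with $a+td>m(A)$ and every $B\in\Gamma_{a+td}^d$ that does not contain $1_{d\times d}$ as a submatrix, $$\operatorname{per}(A\oplus t\,1_{d\times d})>\operatorname{per}(B).$$ -/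

import Mathlib

/-- The `(0,1)`-matrices of order `n` with exactly `d` nonzero entries in each row, forming a
contiguous (non-cyclic) block; `x` is the left-most column of the block of row `i`. -/
def Gam (n d : ℕ) : Set (Matrix (Fin n) (Fin n) ℕ) :=
  {A | ∀ i, ∃ x : ℕ, x + d ≤ n ∧
    ∀ j : Fin n, A i j = if x ≤ (j : ℕ) ∧ (j : ℕ) < x + d then 1 else 0}

/-- The all-ones square matrix of order `d`. -/
def onesMat (d : ℕ) : Matrix (Fin d) (Fin d) ℕ :=
  Matrix.of fun _ _ => 1

/-- The direct sum `A ⊕ B` of square matrices. -/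
def directSum {m n : ℕ} (A : Matrix (Fin m) (Fin m) ℕ) (B : Matrix (Fin n) (Fin n) ℕ) :
    Matrix (Fin (m + n)) (Fin (m + n)) ℕ :=
  Matrix.reindex finSumFinEquiv finSumFinEquiv (Matrix.fromBlocks A 0 0 B)

/-- The direct sum of `t` copies of `C`, with consecutive diagonal blocks. -/
def copies {d : ℕ} (t : ℕ) (C : Matrix (Fin d) (Fin d) ℕ) :
    Matrix (Fin (t * d)) (Fin (t * d)) ℕ :=
  Matrix.reindex ((Equiv.prodComm (Fin d) (Fin t)).trans finProdFinEquiv)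
    ((Equiv.prodComm (Fin d) (Fin t)).trans finProdFinEquiv)
    (Matrix.blockDiagonal fun _ : Fin t => C)

/-- `B` contains the all-ones `d × d` matrix as a submatrix, on some choice of `d` distinct rows
and `d` distinct columns, not necessarily consecutive. -/
def ContainsOnes {n : ℕ} (d : ℕ) (B : Matrix (Fin n) (Fin n) ℕ) : Prop :=
  ∃ r c : Fin d ↪ Fin n, B.submatrix r c = onesMat d

/-! Let d ≥ 2 and g = `bregmanWeight d`, so g^d = d!. Bregman's theorem gives per B ≤ g^(a+td),
while the direct sum has permanent at least (d!)^t = g^(td), because per A ≥ 1. It remains to gain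
the constant factor g^(-a).

The gain is local. Expand the permanent at a column of sum below d, or at two columns of sum d with
some but not all rows in common, and apply Bregman to each term: the bound improves by a factor θ <
1 depending only on d (`exists_isSiteRatio`). Such sites, if no row meets two of them, can be used
one after another, so N of them give θ^N (`card_matchings_le_pow_mul_prod`).

Sites are plentiful. Fewer than d rows start at any given column, so d + 1 consecutive columns of
sum d include two neighbours that overlap partially, and columns of sum above d force short ones
elsewhere. Hence N can grow linearly with the order (`exists_separated_sites`) and θ^N drops below
g^(-a). -/

open Finset in
/-- The permutations `σ` with `σ i ∈ S i` for all `i`: the transversals counted by the permanent of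
the `(0,1)`-matrix whose row `i` has support `S i`. -/
def matchings {ι : Type*} [Fintype ι] [DecidableEq ι] (S : ι → Finset ι) :
    Finset (Equiv.Perm ι) :=
  univ.filter fun σ => ∀ i, σ i ∈ S i

/-- Row supports after the entry `(i, k)` has been selected: row `i` becomes `{k}` and `k` is
removed from the other rows. -/
def pin {ι : Type*} [DecidableEq ι] (S : ι → Finset ι) (i k : ι) : ι → Finset ι :=
  fun j => if j = i then {k} else (S j).erase k

/-- The factor `(r!)^(1/r)` contributed by a row of sum `r` to Bregman's bound. Its value at `0` is
irrelevant for the bound and is chosen positive and small. -/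
noncomputable def bregmanWeight (r : ℕ) : ℝ :=
  if r = 0 then 1 / 2 else (r.factorial : ℝ) ^ (1 / (r : ℝ))

/-! ### Bregman's theorem by convexity of x log x -/

section Matchings

open Finset

variable {ι : Type*} [DecidableEq ι]

lemma pin_self (S : ι → Finset ι) (i k : ι) : pin S i k i = {k} := by simp [pin]

lemma pin_of_ne (S : ι → Finset ι) {i j : ι} (k : ι) (h : j ≠ i) :
    pin S i k j = (S j).erase k := by simp [pin, h]

variable [Fintype ι]

lemma mem_matchings {S : ι → Finset ι} {σ : Equiv.Perm ι} :
    σ ∈ matchings S ↔ ∀ i, σ i ∈ S i := by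
  simp [matchings]

lemma matchings_pin {S : ι → Finset ι} {i k : ι} (hk : k ∈ S i) :
    matchings (pin S i k) = (matchings S).filter fun σ => σ i = k := by
  ext σ
  simp only [mem_matchings, mem_filter]
  constructor
  · intro h
    have hi : σ i = k := by simpa [pin_self] using h i
    refine ⟨fun j => ?_, hi⟩
    by_cases hj : j = i
    · rw [hj, hi]; exact hk
    · have := h j
      rw [pin_of_ne S k hj] at this
      exact mem_of_mem_erase this
  · rintro ⟨h, hi⟩ j
    by_cases hj : j = i
    · rw [hj, pin_self, hi]; exact mem_singleton_self k
    · rw [pin_of_ne S k hj]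
      refine mem_erase.2 ⟨fun h' => hj (σ.injective (h'.trans hi.symm)), h j⟩

/-- Expansion of the permanent along a row. -/
lemma card_matchings_eq_sum_row (S : ι → Finset ι) (i : ι) :
    (matchings S).card = ∑ k ∈ S i, (matchings (pin S i k)).card := by
  rw [card_eq_sum_card_fiberwise (f := fun σ : Equiv.Perm ι => σ i) (t := S i)
    (fun σ hσ => mem_matchings.1 hσ i)]
  exact sum_congr rfl fun k hk => by rw [matchings_pin hk]

/-- Expansion of the permanent along a column. -/
lemma card_matchings_eq_sum_col (S : ι → Finset ι) (k : ι) :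
    (matchings S).card = ∑ i with k ∈ S i, (matchings (pin S i k)).card := by
  rw [card_eq_sum_card_fiberwise (f := fun σ : Equiv.Perm ι => σ.symm k)
    (t := univ.filter fun i => k ∈ S i)
    (fun σ hσ => by simpa using mem_matchings.1 hσ (σ.symm k))]
  refine sum_congr rfl fun i hi => ?_
  rw [matchings_pin (mem_filter.1 hi).2]
  congr 1
  ext σ
  rw [mem_filter, mem_filter, Equiv.symm_apply_eq, eq_comm (a := k)]

lemma bregmanWeight_pos (r : ℕ) : 0 < bregmanWeight r := by
  unfold bregmanWeight
  split_ifs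
  · norm_num
  · positivity

lemma bregmanWeight_pow {r : ℕ} (hr : r ≠ 0) : bregmanWeight r ^ r = r.factorial := by
  rw [bregmanWeight, if_neg hr, one_div, Real.rpow_inv_natCast_pow (by positivity) hr]

lemma bregmanWeight_one : bregmanWeight 1 = 1 := by
  simpa using bregmanWeight_pow one_ne_zero

lemma mul_log_bregmanWeight {r : ℕ} :
    (r : ℝ) * Real.log (bregmanWeight r) = Real.log r.factorial := by
  rcases eq_or_ne r 0 with rfl | hr
  · simp
  · rw [← bregmanWeight_pow hr, Real.log_pow]

/-- Convexity of `x log x` along the row expansion. -/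
lemma card_mul_log_card_le (S : ι → Finset ι) (i : ι) (hS : (matchings S).Nonempty) :
    ((matchings S).card : ℝ) * Real.log (matchings S).card ≤
      ∑ σ ∈ matchings S,
        (Real.log (matchings (pin S i (σ i))).card + Real.log (S i).card) := by
  obtain ⟨σ₀, hσ₀⟩ := hS
  have hr : 0 < ((S i).card : ℝ) := by
    exact_mod_cast card_pos.2 ⟨σ₀ i, mem_matchings.1 hσ₀ i⟩
  have hP : 0 < ((matchings S).card : ℝ) := by exact_mod_cast card_pos.2 ⟨σ₀, hσ₀⟩
  have hsum : ((matchings S).card : ℝ) = ∑ k ∈ S i, ((matchings (pin S i k)).card : ℝ) := by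
    exact_mod_cast card_matchings_eq_sum_row S i
  have hJ := Real.convexOn_mul_log.map_sum_le (t := S i) (w := fun _ => ((S i).card : ℝ)⁻¹)
    (p := fun k => ((matchings (pin S i k)).card : ℝ)) (fun _ _ => by positivity)
    (by simp [hr.ne']) (fun _ _ => by simp)
  simp only [smul_eq_mul, ← mul_sum] at hJ
  rw [← hsum, Real.log_mul (by positivity) hP.ne', Real.log_inv, mul_assoc] at hJ
  have hJ' := le_of_mul_le_mul_left hJ (by positivity)
  -- Each k is the value σ i of exactly as many σ as there are transversals pinned at (i, k), so
  -- Jensen's sum over k becomes a sum over σ.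
  have hfib : ∑ k ∈ S i, ((matchings (pin S i k)).card : ℝ) *
      Real.log (matchings (pin S i k)).card =
      ∑ σ ∈ matchings S, Real.log (matchings (pin S i (σ i))).card := by
    rw [← sum_fiberwise_of_maps_to (s := matchings S) (t := S i) (g := fun σ => σ i)
      (fun σ hσ => mem_matchings.1 hσ i)]
    refine sum_congr rfl fun k hk => ?_
    rw [sum_congr rfl (g := fun _ => Real.log (matchings (pin S i k)).card)
      (fun σ hσ => by rw [(mem_filter.1 hσ).2]), sum_const, nsmul_eq_mul, matchings_pin hk]
  rw [sum_add_distrib, ← hfib, sum_const, nsmul_eq_mul]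
  linarith

/-- The rows `i` for which `σ i ∈ S j` correspond to the entries of row `j`. -/
lemma card_filter_apply_mem {S : ι → Finset ι} {U : Finset ι}
    (hU : ∀ j ∉ U, ∃ k, S j = {k} ∧ ∀ i, i ≠ j → k ∉ S i) {σ : Equiv.Perm ι}
    (hσ : σ ∈ matchings S) (j : ι) :
    ((U.erase j).filter fun i => σ i ∈ S j).card = (S j).card - 1 := by
  have h1 : (U.erase j).filter (fun i => σ i ∈ S j) =
      ((S j).map σ.symm.toEmbedding).erase j := by
    ext i
    simp only [mem_filter, mem_erase, mem_map_equiv, Equiv.symm_symm]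
    constructor
    · rintro ⟨⟨h1, -⟩, h2⟩; exact ⟨h1, h2⟩
    · rintro ⟨h1, h2⟩
      refine ⟨⟨h1, ?_⟩, h2⟩
      by_contra hi
      obtain ⟨k, hk, hk'⟩ := hU i hi
      have := mem_matchings.1 hσ i
      rw [hk, mem_singleton] at this
      exact hk' j (Ne.symm h1) (this ▸ h2)
  rw [h1, card_erase_of_mem, card_map]
  simpa using mem_matchings.1 hσ j

/-- Bregman's bound, for rows of which those outside `U` are already pinned. -/
lemma card_matchings_le_prod_of_pinned (U : Finset ι) (S : ι → Finset ι)
    (hU : ∀ j ∉ U, ∃ k, S j = {k} ∧ ∀ i, i ≠ j → k ∉ S i) :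
    ((matchings S).card : ℝ) ≤ ∏ i ∈ U, bregmanWeight (S i).card := by
  induction hm : U.card generalizing U S with
  | zero =>
    rw [card_eq_zero] at hm
    subst hm
    rw [prod_empty]
    norm_cast
    refine card_le_one.2 fun σ hσ τ hτ => Equiv.ext fun i => ?_
    obtain ⟨k, hk, -⟩ := hU i (notMem_empty i)
    have h1 := mem_matchings.1 hσ i
    have h2 := mem_matchings.1 hτ i
    rw [hk, mem_singleton] at h1 h2
    rw [h1, h2]
  | succ m ih =>
    rcases (matchings S).eq_empty_or_nonempty with hS | hS
    · rw [hS, card_empty, Nat.cast_zero]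
      exact prod_nonneg fun i _ => (bregmanWeight_pos _).le
    have hP : 0 < ((matchings S).card : ℝ) := by exact_mod_cast card_pos.2 hS
    have hone : ∀ σ ∈ matchings S, ∀ i ∈ U, Real.log (matchings (pin S i (σ i))).card ≤
        ∑ j ∈ U.erase i, Real.log (bregmanWeight ((S j).erase (σ i)).card) := by
      intro σ hσ i hi
      have hmem := mem_matchings.1 hσ i
      have hpos : 0 < ((matchings (pin S i (σ i))).card : ℝ) := by
        rw [matchings_pin hmem]
        exact Nat.cast_pos.2 (card_pos.2 ⟨σ, mem_filter.2 ⟨hσ, rfl⟩⟩)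
      have := ih (U.erase i) (pin S i (σ i)) (fun j hj => ?_) (by rw [card_erase_of_mem hi, hm]; rfl)
      · rw [← Real.log_prod (fun j _ => (bregmanWeight_pos _).ne')]
        refine Real.log_le_log hpos (this.trans_eq (prod_congr rfl fun j hj => ?_))
        rw [pin_of_ne S _ (ne_of_mem_erase hj)]
      · by_cases hji : j = i
        · subst hji
          refine ⟨σ j, pin_self _ _ _, fun l hl => ?_⟩
          rw [pin_of_ne S _ hl]
          exact notMem_erase _ _
        · obtain ⟨k, hk, hk'⟩ := hU j (fun h => hj (mem_erase.2 ⟨hji, h⟩))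
          have hne : k ≠ σ i := fun h => hk' i (Ne.symm hji) (h ▸ hmem)
          refine ⟨k, ?_, fun l hl => ?_⟩
          · rw [pin_of_ne S _ hji, hk, erase_eq_of_notMem]
            simpa using hne.symm
          · by_cases hli : l = i
            · subst hli
              rw [pin_self]; simpa using hne
            · rw [pin_of_ne S _ hli]
              exact fun h => hk' l hl (mem_of_mem_erase h)
    -- For fixed σ, row j loses an entry for exactly r_j - 1 of the other rows i. As r log w(r) =
    -- log r!, these losses together with log r_j leave exactly m + 1 copies of log w(r_j).
    have htwo : ∀ σ ∈ matchings S,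
        ∑ i ∈ U, (Real.log (matchings (pin S i (σ i))).card + Real.log (S i).card) ≤
          (m + 1) * ∑ j ∈ U, Real.log (bregmanWeight (S j).card) := by
      intro σ hσ
      rw [sum_add_distrib]
      have hswap : ∑ i ∈ U, ∑ j ∈ U.erase i,
          Real.log (bregmanWeight ((S j).erase (σ i)).card) =
          ∑ j ∈ U, ∑ i ∈ U.erase j, Real.log (bregmanWeight ((S j).erase (σ i)).card) :=
        sum_comm' fun i j => by simp only [mem_erase]; tauto
      have hinner : ∀ j ∈ U, ∑ i ∈ U.erase j,
          Real.log (bregmanWeight ((S j).erase (σ i)).card) + Real.log (S j).card =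
          (m + 1) * Real.log (bregmanWeight (S j).card) := by
        intro j hj
        have hr : 0 < (S j).card := card_pos.2 ⟨_, mem_matchings.1 hσ j⟩
        obtain ⟨r, hr⟩ : ∃ r, (S j).card = r + 1 := ⟨_, (Nat.succ_pred_eq_of_pos hr).symm⟩
        have hc := card_filter_apply_mem hU hσ j
        have hc' := card_filter_add_card_filter_not (s := U.erase j) (fun i => σ i ∈ S j)
        rw [hc, card_erase_of_mem hj, hm, hr] at hc'
        simp only [Nat.add_sub_cancel] at hc'
        rw [← sum_filter_add_sum_filter_not _ (fun i => σ i ∈ S j),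
          sum_congr rfl (g := fun _ => Real.log (bregmanWeight r)) (fun i hi => by
            rw [card_erase_of_mem (mem_filter.1 hi).2, hr]; rfl),
          sum_congr (s₁ := (U.erase j).filter fun i => ¬ σ i ∈ S j) rfl
            (g := fun _ => Real.log (bregmanWeight (r + 1))) (fun i hi => by
            rw [erase_eq_of_notMem (mem_filter.1 hi).2, hr]),
          sum_const, sum_const, hc, nsmul_eq_mul, nsmul_eq_mul, hr, Nat.add_sub_cancel,
          mul_log_bregmanWeight]
        have hf : Real.log ((r + 1).factorial : ℝ) = Real.log r.factorial + Real.log (r + 1 : ℕ) := by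
          rw [Nat.factorial_succ, Nat.cast_mul, Real.log_mul (by positivity) (by positivity),
            add_comm]
        rw [← mul_log_bregmanWeight] at hf
        have hm' : (m : ℝ) = r + ((U.erase j).filter fun i => ¬ σ i ∈ S j).card := by
          exact_mod_cast hc'.symm
        rw [hm']
        push_cast at hf ⊢
        linarith
      calc _ ≤ ∑ i ∈ U, ∑ j ∈ U.erase i, Real.log (bregmanWeight ((S j).erase (σ i)).card) +
            ∑ i ∈ U, Real.log (S i).card := by gcongr with i hi; exact hone σ hσ i hi
        _ = _ := by rw [hswap, ← sum_add_distrib, sum_congr rfl hinner, mul_sum]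
    have hthree : (m + 1 : ℝ) * ((matchings S).card * Real.log (matchings S).card) ≤
        (m + 1) * ((matchings S).card * ∑ j ∈ U, Real.log (bregmanWeight (S j).card)) := by
      calc _ = ∑ i ∈ U, ((matchings S).card : ℝ) * Real.log (matchings S).card := by
            rw [sum_const, hm, nsmul_eq_mul]; push_cast; ring
        _ ≤ ∑ i ∈ U, ∑ σ ∈ matchings S,
            (Real.log (matchings (pin S i (σ i))).card + Real.log (S i).card) :=
          sum_le_sum fun i _ => card_mul_log_card_le S i hS
        _ = ∑ σ ∈ matchings S, ∑ i ∈ U,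
            (Real.log (matchings (pin S i (σ i))).card + Real.log (S i).card) := sum_comm
        _ ≤ ∑ σ ∈ matchings S, (m + 1) * ∑ j ∈ U, Real.log (bregmanWeight (S j).card) :=
          sum_le_sum htwo
        _ = _ := by rw [sum_const, nsmul_eq_mul]; ring
    have hfour := le_of_mul_le_mul_left (le_of_mul_le_mul_left hthree (by positivity)) hP
    rw [← Real.log_prod (fun j _ => (bregmanWeight_pos _).ne')] at hfour
    exact (Real.log_le_log_iff hP (prod_pos fun j _ => bregmanWeight_pos _)).1 hfour

/-- **Bregman's theorem**: the permanent of a `(0,1)`-matrix with row sums `r i` is at most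
`∏ i, (r i)!^(1 / r i)`. -/
theorem card_matchings_le_prod_bregmanWeight (S : ι → Finset ι) :
    ((matchings S).card : ℝ) ≤ ∏ i, bregmanWeight (S i).card :=
  card_matchings_le_prod_of_pinned univ S fun j hj => (hj (mem_univ j)).elim

end Matchings

/-! ### Inequalities between Bregman weights -/

section WeightInequalities

/-- `((k+2)/(k+1))^(k+1)` increases with `k`. -/
lemma one_add_inv_pow_le_succ (k : ℕ) :
    ((k + 2 : ℝ) / (k + 1)) ^ (k + 1) ≤ ((k + 3 : ℝ) / (k + 2)) ^ (k + 2) := by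
  have hB := one_add_mul_le_pow (a := -1 / ((k : ℝ) + 2) ^ 2) (by
    rw [le_div_iff₀ (by positivity)]; nlinarith [Nat.cast_nonneg (α := ℝ) k]) (k + 2)
  have h1 : 1 + -1 / ((k : ℝ) + 2) ^ 2 = ((k + 3) / (k + 2)) * ((k + 1) / (k + 2)) := by
    field_simp; ring
  have h2 : 1 + ((k + 2 : ℕ) : ℝ) * (-1 / ((k : ℝ) + 2) ^ 2) = (k + 1) / (k + 2) := by
    push_cast; field_simp; ring
  rw [h1, h2, mul_pow] at hB
  have h3 : ((k + 2 : ℝ) / (k + 1)) ^ (k + 1) =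
      ((k + 1 : ℝ) / (k + 2)) / ((k + 1 : ℝ) / (k + 2)) ^ (k + 2) := by
    rw [pow_succ ((k + 1 : ℝ) / (k + 2)) (k + 1), div_mul_cancel_right₀ (by positivity),
      ← inv_pow, inv_div]
  rw [h3, div_le_iff₀ (by positivity)]
  exact hB

/-- Iterated, this writes (k+1)^k / k! as the product over j < k of ((j+2)/(j+1))^(j+1). These
factors increase and are at least 2, which yields the two bounds that follow. -/
lemma succ_pow_div_factorial_succ (k : ℕ) :
    ((k + 1 : ℕ) + 1 : ℝ) ^ (k + 1) / (k + 1).factorial =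
      (k + 1 : ℝ) ^ k / k.factorial * ((k + 2 : ℝ) / (k + 1)) ^ (k + 1) := by
  have : (k.factorial : ℝ) ≠ 0 := by positivity
  rw [Nat.factorial_succ, div_pow]
  push_cast
  field_simp
  ring

lemma succ_pow_div_factorial_le (k : ℕ) :
    (k + 1 : ℝ) ^ k / k.factorial ≤ ((k + 2 : ℝ) / (k + 1)) ^ ((k + 1) * k) := by
  induction k with
  | zero => simp
  | succ k ih =>
    rw [succ_pow_div_factorial_succ]
    calc _ ≤ ((k + 2 : ℝ) / (k + 1)) ^ ((k + 1) * k) * ((k + 2 : ℝ) / (k + 1)) ^ (k + 1) := by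
          gcongr
      _ = (((k + 2 : ℝ) / (k + 1)) ^ (k + 1)) ^ (k + 1) := by rw [pow_mul, ← pow_succ]
      _ ≤ (((k + 3 : ℝ) / (k + 2)) ^ (k + 2)) ^ (k + 1) := by
          gcongr; exact one_add_inv_pow_le_succ k
      _ = _ := by
          rw [← pow_mul]; push_cast; congr 2 <;> ring

lemma two_pow_le_succ_pow_div_factorial (k : ℕ) :
    (2 : ℝ) ^ k ≤ (k + 1 : ℝ) ^ k / k.factorial := by
  induction k with
  | zero => simp
  | succ k ih =>
    rw [succ_pow_div_factorial_succ, pow_succ]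
    have hB := one_add_mul_le_pow (a := 1 / ((k : ℝ) + 1)) (by
      have : (0 : ℝ) ≤ 1 / ((k : ℝ) + 1) := by positivity
      linarith) (k + 1)
    have h1 : 1 + 1 / ((k : ℝ) + 1) = (k + 2) / (k + 1) := by field_simp; ring
    have h2 : 1 + ((k + 1 : ℕ) : ℝ) * (1 / ((k : ℝ) + 1)) = 2 := by push_cast; field_simp; ring
    rw [h1, h2] at hB
    gcongr

lemma bregmanWeight_ratio_pow {k : ℕ} (hk : k ≠ 0) :
    (bregmanWeight k / bregmanWeight (k + 1)) ^ ((k + 1) * k) =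
      ((k + 1 : ℝ) ^ k / k.factorial)⁻¹ := by
  have : (k.factorial : ℝ) ≠ 0 := by positivity
  rw [div_pow, pow_mul (bregmanWeight (k + 1)), bregmanWeight_pow (Nat.succ_ne_zero k),
    mul_comm (k + 1) k, pow_mul, bregmanWeight_pow hk, Nat.factorial_succ, inv_div]
  push_cast
  rw [mul_pow, pow_succ]
  field_simp

lemma le_bregmanWeight_ratio {k : ℕ} (hk : k ≠ 0) :
    (k + 1 : ℝ) / (k + 2) ≤ bregmanWeight k / bregmanWeight (k + 1) := by
  have h1 := bregmanWeight_pos k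
  have h2 := bregmanWeight_pos (k + 1)
  rw [← pow_le_pow_iff_left₀ (by positivity) (by positivity)
    (show (k + 1) * k ≠ 0 by positivity), bregmanWeight_ratio_pow hk, ← inv_div (k + 2 : ℝ),
    inv_pow]
  exact inv_anti₀ (by positivity) (succ_pow_div_factorial_le k)

/-- With `le_bregmanWeight_ratio`, this puts (k+2)(1 - ratio) in [1/2, 1], the range required in
`quadratic_strict_log_convex`. -/
lemma bregmanWeight_ratio_le {k : ℕ} (hk : k ≠ 0) :
    bregmanWeight k / bregmanWeight (k + 1) ≤ 1 - 1 / (2 * (k + 2 : ℝ)) := by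
  have h1 := bregmanWeight_pos k
  have h2 := bregmanWeight_pos (k + 1)
  have h3 : 1 / (2 * (k + 2 : ℝ)) ≤ 1 / 2 := by
    rw [div_le_div_iff₀ (by positivity) (by positivity)]; nlinarith [Nat.cast_nonneg (α := ℝ) k]
  rw [← pow_le_pow_iff_left₀ (by positivity) (by linarith)
    (show (k + 1) * k ≠ 0 by positivity), bregmanWeight_ratio_pow hk]
  have hB := one_add_mul_le_pow (a := -(1 / (2 * (k + 2 : ℝ)))) (by linarith) (k + 1)
  have h4 : (1 / 2 : ℝ) ≤ 1 + ((k + 1 : ℕ) : ℝ) * -(1 / (2 * (k + 2 : ℝ))) := by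
    have : 1 + ((k + 1 : ℕ) : ℝ) * -(1 / (2 * (k + 2 : ℝ))) - 1 / 2 = 1 / (2 * (k + 2)) := by
      push_cast; field_simp; ring
    have h5 : 0 ≤ 1 / (2 * (k + 2 : ℝ)) := by positivity
    linarith
  calc ((k + 1 : ℝ) ^ k / k.factorial)⁻¹ ≤ ((2 : ℝ) ^ k)⁻¹ :=
        inv_anti₀ (by positivity) (two_pow_le_succ_pow_div_factorial k)
    _ = (1 / 2 : ℝ) ^ k := by rw [one_div, inv_pow]
    _ ≤ ((1 - 1 / (2 * (k + 2 : ℝ))) ^ (k + 1)) ^ k := by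
        gcongr
        exact h4.trans (hB.trans_eq (by rw [sub_eq_add_neg]))
    _ = _ := by rw [← pow_mul]

/-- A column meeting fewer than `d` rows, all of sum `d`, makes Bregman's bound strict. -/
lemma mul_bregmanWeight_pow_lt {d c : ℕ} (hd : 2 ≤ d) (hc : c < d) :
    (c : ℝ) * bregmanWeight (d - 1) ^ (c - 1) < bregmanWeight d ^ c := by
  obtain ⟨k, rfl⟩ : ∃ k, d = k + 1 := ⟨d - 1, by omega⟩
  rcases Nat.eq_zero_or_pos c with rfl | hc0
  · simp
  simp only [Nat.add_sub_cancel]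
  have hk : k ≠ 0 := by omega
  set x := bregmanWeight k with hx
  set g := bregmanWeight (k + 1) with hg
  have hx0 : 0 < x := bregmanWeight_pos _
  have hg0 : 0 < g := bregmanWeight_pos _
  obtain ⟨j, hj⟩ : ∃ j, k + 1 = c + (j + 1) := ⟨k - c, by omega⟩
  have hjR : (k + 1 : ℝ) = c + (j + 1) := by exact_mod_cast hj
  have hq : (k : ℝ) / (k + 1) < x / g := by
    refine lt_of_lt_of_le ?_ (le_bregmanWeight_ratio hk)
    rw [div_lt_div_iff₀ (by positivity) (by positivity)]
    linarith
  have hB := one_add_mul_le_pow (a := -(1 / (k + 1 : ℝ))) (by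
    have : 1 / (k + 1 : ℝ) ≤ 1 := by
      rw [div_le_one (by positivity)]; linarith [Nat.cast_nonneg (α := ℝ) k]
    linarith) (j + 1)
  have h1 : 1 + ((j + 1 : ℕ) : ℝ) * -(1 / (k + 1 : ℝ)) = c / (k + 1) := by
    rw [eq_div_iff (by positivity)]; field_simp; push_cast; linarith
  have h2 : 1 + -(1 / (k + 1 : ℝ)) = k / (k + 1) := by field_simp; ring
  rw [h1, h2] at hB
  have hlt : (c : ℝ) / (k + 1) < (x / g) ^ (j + 1) :=
    hB.trans_lt (pow_lt_pow_left₀ hq (by positivity) (by omega))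
  rw [div_lt_iff₀ (by positivity), div_pow] at hlt
  -- This is the equality case c = d, namely d · (d-1)! = d!; dividing by it reduces the claim to
  -- `hlt`.
  have hpow : x ^ (c - 1) * x ^ (j + 1) * (k + 1) = g ^ c * g ^ (j + 1) := by
    rw [← pow_add, ← pow_add, ← hj, hg, bregmanWeight_pow (Nat.succ_ne_zero k),
      show c - 1 + (j + 1) = k by omega, hx, bregmanWeight_pow hk, Nat.factorial_succ]
    push_cast; ring
  calc (c : ℝ) * x ^ (c - 1) < x ^ (j + 1) / g ^ (j + 1) * (k + 1) * x ^ (c - 1) := by gcongr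
    _ = (x ^ (c - 1) * x ^ (j + 1) * (k + 1)) / g ^ (j + 1) := by ring
    _ = g ^ c := by rw [hpow]; field_simp

/-- A strictly log-convex sequence with boundary values `1` is less than `1` in the interior. -/
lemma lt_one_of_strict_log_convex {N : ℕ} {F : ℕ → ℝ} (hpos : ∀ v ≤ N, 0 < F v)
    (h0 : F 0 = 1) (hN : F N = 1)
    (hF : ∀ v, 0 < v → v < N → F v ^ 2 < F (v - 1) * F (v + 1)) {v : ℕ} (hv0 : 0 < v)
    (hvN : v < N) : F v < 1 := by
  by_contra! hv
  obtain ⟨w, hw, hmax⟩ := Finset.exists_max_image (Finset.Ioo 0 N) F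
    ⟨v, Finset.mem_Ioo.2 ⟨hv0, hvN⟩⟩
  rw [Finset.mem_Ioo] at hw
  have hle : ∀ u ≤ N, F u ≤ F w := by
    intro u hu
    have h1 : 1 ≤ F w := hv.trans (hmax v (Finset.mem_Ioo.2 ⟨hv0, hvN⟩))
    rcases Nat.eq_zero_or_pos u with rfl | hu0
    · rwa [h0]
    rcases hu.eq_or_lt with rfl | hu
    · rwa [hN]
    exact hmax u (Finset.mem_Ioo.2 ⟨hu0, hu⟩)
  have h1 := hle (w - 1) (by omega)
  have h2 := hle (w + 1) (by omega)
  have h3 := hF w hw.1 hw.2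
  have h4 := hpos (w + 1) (by omega)
  have h5 := hpos w (by omega)
  nlinarith [mul_le_mul h1 h2 h4.le h5.le]

/-- With y = sd - vs², right side minus left side is 1 - 2(1-y)² - 2s²(d-v) + s⁴. As d ≥ 3, s²d is
at most (sd)²/3, which leaves a polynomial inequality in a = sd on [1/2, 1]. -/
lemma quadratic_strict_log_convex {d s v : ℝ} (hd : 3 ≤ d) (hv : 0 ≤ v) (hvd : v ≤ d)
    (hs1 : 1 / 2 ≤ s * d) (hs2 : s * d ≤ 1) :
    ((d - v * s) ^ 2 - (d - v)) ^ 2 <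
      ((d - (v - 1) * s) ^ 2 - (d - (v - 1))) * ((d - (v + 1) * s) ^ 2 - (d - (v + 1))) := by
  have hs0 : 0 < s := by
    by_contra! h
    nlinarith
  set a := s * d with ha
  set y := a - v * s ^ 2 with hy
  have hb : s ^ 2 * d ≤ a ^ 2 / 3 := by
    have : s ^ 2 * d * 3 ≤ a ^ 2 := by rw [ha]; nlinarith [mul_pos hs0 hs0]
    linarith
  have hv1 : v * s ^ 2 ≤ s ^ 2 * d := by nlinarith [sq_nonneg s]
  have hy1 : a - a ^ 2 / 3 ≤ y := by linarith
  have hy2 : y ≤ 1 := by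
    have : 0 ≤ v * s ^ 2 := by positivity
    linarith
  have hz : s ^ 2 * (d - v) ≤ a ^ 2 / 3 := by
    have : 0 ≤ v * s ^ 2 := by positivity
    nlinarith
  have hy3 : (1 - y) ^ 2 ≤ (1 - (a - a ^ 2 / 3)) ^ 2 := by
    apply pow_le_pow_left₀ <;> linarith
  have hpoly : 2 * (1 - (a - a ^ 2 / 3)) ^ 2 < 1 - 2 * (a ^ 2 / 3) := by
    have h1 : 0 ≤ a * (a - 9 / 10) ^ 2 := by positivity
    have h2 : 0 ≤ (a - 1 / 2) * (1 - a) := mul_nonneg (by linarith) (by linarith)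
    have h3 : 0 ≤ a ^ 3 * (1 - a) := mul_nonneg (by positivity) (by linarith)
    nlinarith
  have key : ((d - (v - 1) * s) ^ 2 - (d - (v - 1))) * ((d - (v + 1) * s) ^ 2 - (d - (v + 1))) -
      ((d - v * s) ^ 2 - (d - v)) ^ 2 =
      1 - 2 * (1 - y) ^ 2 - 2 * (s ^ 2 * (d - v)) + s ^ 4 := by
    rw [hy, ha]; ring
  have : 0 < s ^ 4 := by positivity
  linarith

/-- Two columns of sum `d` with `u` common rows and `v` further rows each, `u` and `v` positive and
all rows of sum `d`, make Bregman's bound strict. -/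
lemma two_columns_bregmanWeight_lt {d u v : ℕ} (hu : 0 < u) (hv : 0 < v) (huv : u + v = d) :
    bregmanWeight (d - 2) ^ u * bregmanWeight (d - 1) ^ (2 * v) *
      ((u / bregmanWeight (d - 2) + v / bregmanWeight (d - 1)) ^ 2 -
        u / bregmanWeight (d - 2) ^ 2) < bregmanWeight d ^ (u + 2 * v) := by
  obtain rfl | hd3 : d = 2 ∨ 3 ≤ d := by omega
  · obtain rfl : u = 1 := by omega
    obtain rfl : v = 1 := by omega
    have h2 : bregmanWeight 2 ^ 2 = 2 := by simpa using bregmanWeight_pow two_ne_zero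
    have hp := bregmanWeight_pos 2
    -- The weight of an emptied row matters here: 1/2 makes the left side 5/2, below 2√2, whereas
    -- the weight 1 would make it 3.
    have h0 : bregmanWeight 0 = 1 / 2 := by simp [bregmanWeight]
    have h3 : bregmanWeight 2 ^ 3 = 2 * bregmanWeight 2 := by rw [pow_succ, h2]
    have h4 : 5 / 4 < bregmanWeight 2 := by nlinarith
    norm_num [h0, bregmanWeight_one, h3]
    linarith
  obtain ⟨k, rfl⟩ : ∃ k, d = k + 2 := ⟨d - 2, by omega⟩
  have hk : k ≠ 0 := by omega
  rw [show k + 2 - 2 = k by omega, show k + 2 - 1 = k + 1 by omega]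
  set x := bregmanWeight k with hx
  set y := bregmanWeight (k + 1) with hy
  set g := bregmanWeight (k + 2) with hg
  have hx0 : 0 < x := bregmanWeight_pos _
  have hy0 : 0 < y := bregmanWeight_pos _
  have hg0 : 0 < g := bregmanWeight_pos _
  have hxk : x ^ k = k.factorial := bregmanWeight_pow hk
  have hyk : y ^ (k + 1) = (k + 1) * k.factorial := by
    rw [hy, bregmanWeight_pow (Nat.succ_ne_zero k), Nat.factorial_succ]; push_cast; ring
  have hgk : g ^ (k + 2) = (k + 2) * ((k + 1) * k.factorial) := by
    rw [hg, bregmanWeight_pow (by omega), Nat.factorial_succ, Nat.factorial_succ]; push_cast; ring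
  have hfac : (0 : ℝ) < k.factorial := by positivity
  have hw1 := le_bregmanWeight_ratio hk
  have hw2 := bregmanWeight_ratio_le hk
  rw [← hx, ← hy] at hw1 hw2
  set s := 1 - x / y with hs
  have hs1 : 1 / 2 ≤ s * (k + 2) := by
    have : 1 / (2 * (k + 2 : ℝ)) ≤ s := by linarith
    calc (1 / 2 : ℝ) = 1 / (2 * (k + 2 : ℝ)) * (k + 2) := by field_simp
      _ ≤ _ := by gcongr
  have hs2 : s * (k + 2) ≤ 1 := by
    have : s ≤ 1 / (k + 2 : ℝ) := by
      have h : (k + 1 : ℝ) / (k + 2) = 1 - 1 / (k + 2) := by field_simp; ring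
      linarith
    calc s * (k + 2) ≤ 1 / (k + 2 : ℝ) * (k + 2) := by gcongr
      _ = 1 := by field_simp
  let P : ℝ → ℝ := fun t => (k + 2 - t * s) ^ 2 - (k + 2 - t)
  -- F v is the ratio of the two sides when u = d - v. It is 1 at both ends, for identical columns
  -- (v = 0) and for disjoint ones (v = d). Log-convexity comes from P alone, the other factors
  -- being geometric in v.
  let F : ℕ → ℝ := fun t => ((k + 2 : ℝ) * (k + 1))⁻¹ * (y ^ 2 / (x * g)) ^ t * P t
  have hk1 : (1 : ℝ) ≤ k := by exact_mod_cast Nat.one_le_iff_ne_zero.2 hk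
  have hs0 : 0 < s := by
    by_contra! h
    nlinarith
  have hPpos : ∀ t : ℝ, 0 ≤ t → t ≤ k + 2 → 0 < P t := by
    intro t ht0 ht
    have h1 : 0 ≤ (k + 2 - t) := by linarith
    have h2 : k + 2 - t * s ≥ k + 1 := by nlinarith
    have h3 : k + 2 - t * s ≥ (k + 2 - t) + t * (x / y) := by rw [hs]; linarith
    have h5 : 0 < x / y := by positivity
    rcases ht0.eq_or_lt with rfl | ht0
    · show 0 < (k + 2 - 0 * s) ^ 2 - (k + 2 - 0); nlinarith
    · have h4 : 0 < t * (x / y) := by positivity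
      show 0 < (k + 2 - t * s) ^ 2 - (k + 2 - t)
      nlinarith
  have hFv : F v < 1 := by
    refine lt_one_of_strict_log_convex (N := k + 2) (F := F) ?_ ?_ ?_ ?_ hv (by omega)
    · intro t ht
      have := hPpos t (by positivity) (by exact_mod_cast ht)
      positivity
    · simp only [F, P]
      field_simp
      push_cast
      ring
    · have : P ((k + 2 : ℕ) : ℝ) = (k + 2) ^ 2 * (x / y) ^ 2 := by
        simp only [P, hs]; push_cast; ring
      simp only [F, this]
      have hy2 : (y ^ 2) ^ (k + 2) = ((k + 1) * k.factorial) ^ 2 * y ^ 2 := by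
        rw [← hyk]; ring
      have hx2 : x ^ (k + 2) = k.factorial * x ^ 2 := by rw [← hxk]; ring
      rw [div_pow, mul_pow, hgk, hx2, hy2]
      field_simp
    · intro t ht0 ht
      obtain ⟨r, rfl⟩ : ∃ r, t = r + 1 := ⟨t - 1, by omega⟩
      have hq := quadratic_strict_log_convex (d := k + 2) (s := s) (v := ((r + 1 : ℕ) : ℝ))
        (by linarith) (by positivity) (by exact_mod_cast ht.le) hs1 hs2
      have e1 : F (r + 1) ^ 2 = (((k + 2 : ℝ) * (k + 1))⁻¹ * (y ^ 2 / (x * g)) ^ (r + 1)) ^ 2 *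
          ((k + 2 - ((r + 1 : ℕ) : ℝ) * s) ^ 2 - (k + 2 - ((r + 1 : ℕ) : ℝ))) ^ 2 := by
        simp only [F, P]; ring
      have e2 : F (r + 1 - 1) * F (r + 1 + 1) =
          (((k + 2 : ℝ) * (k + 1))⁻¹ * (y ^ 2 / (x * g)) ^ (r + 1)) ^ 2 *
          (((k + 2 - (((r + 1 : ℕ) : ℝ) - 1) * s) ^ 2 - (k + 2 - (((r + 1 : ℕ) : ℝ) - 1))) *
          ((k + 2 - (((r + 1 : ℕ) : ℝ) + 1) * s) ^ 2 - (k + 2 - (((r + 1 : ℕ) : ℝ) + 1)))) := by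
        simp only [F, P, Nat.add_sub_cancel]; push_cast; ring
      rw [e1, e2]
      gcongr
  have hPv : P v = (u + v * (x / y)) ^ 2 - u := by
    have : (k + 2 : ℝ) = u + v := by exact_mod_cast huv.symm
    simp only [P, hs, this]; ring
  have hpowx : x ^ u * x ^ v = k.factorial * x ^ 2 := by
    rw [← pow_add, huv, pow_add, hxk]
  have hpowg : g ^ u * g ^ v = (k + 2) * ((k + 1) * k.factorial) := by
    rw [← pow_add, huv, hgk]
  have hEq : x ^ u * y ^ (2 * v) * ((u / x + v / y) ^ 2 - u / x ^ 2) =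
      F v * g ^ (u + 2 * v) := by
    have h1 : (u / x + v / y) ^ 2 - u / x ^ 2 = P v / x ^ 2 := by
      rw [hPv]; field_simp
    have h2 : x ^ u = k.factorial * x ^ 2 / x ^ v := by rw [← hpowx]; field_simp
    have h3 : g ^ (u + 2 * v) = (k + 2) * ((k + 1) * k.factorial) * g ^ v := by
      rw [← hpowg]; ring
    rw [h1, h2, h3]
    simp only [F]
    rw [div_pow, mul_pow, ← pow_mul]
    field_simp
  rw [hEq]
  exact mul_lt_of_lt_one_left (by positivity) hFv

end WeightInequalities

/-! ### Sites and the improved Bregman bound -/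

open Finset in
/-- A set `Q` of one or two columns, met only by rows of sum `d`, at which expanding the permanent
improves Bregman's bound. -/
def IsSite {ι : Type*} [Fintype ι] [DecidableEq ι] (d : ℕ) (S : ι → Finset ι)
    (Q : Finset ι) : Prop :=
  (∃ k, Q = {k} ∧ (∀ i, k ∈ S i → (S i).card = d) ∧ (univ.filter fun i => k ∈ S i).card < d) ∨
  ∃ k l, k ≠ l ∧ Q = {k, l} ∧ (∀ i, k ∈ S i ∨ l ∈ S i → (S i).card = d) ∧
    (univ.filter fun i => k ∈ S i).card = d ∧ (univ.filter fun i => l ∈ S i).card = d ∧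
    0 < (univ.filter fun i => k ∈ S i ∧ l ∈ S i).card ∧
    (univ.filter fun i => k ∈ S i ∧ l ∈ S i).card < d

/-- `θ` bounds the relative improvement of Bregman's bound at a site. -/
def IsSiteRatio (d : ℕ) (θ : ℝ) : Prop :=
  (∀ c : ℕ, c < d → (c : ℝ) * bregmanWeight (d - 1) ^ (c - 1) ≤ θ * bregmanWeight d ^ c) ∧
  ∀ u v : ℕ, 0 < u → 0 < v → u + v = d →
    bregmanWeight (d - 2) ^ u * bregmanWeight (d - 1) ^ (2 * v) *
      ((u / bregmanWeight (d - 2) + v / bregmanWeight (d - 1)) ^ 2 -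
        u / bregmanWeight (d - 2) ^ 2) ≤ θ * bregmanWeight d ^ (u + 2 * v)

section Sites

open Finset

lemma exists_lt_one_forall_le {α : Type*} (s : Finset α) (f : α → ℝ) (hf : ∀ a ∈ s, f a < 1) :
    ∃ θ : ℝ, 0 < θ ∧ θ < 1 ∧ ∀ a ∈ s, f a ≤ θ := by
  classical
  induction s using Finset.induction_on with
  | empty => exact ⟨1 / 2, by norm_num, by norm_num, by simp⟩
  | insert a s ha ih =>
    obtain ⟨θ, h0, h1, h2⟩ := ih fun b hb => hf b (mem_insert_of_mem hb)
    refine ⟨max θ (f a), lt_max_of_lt_left h0, max_lt h1 (hf a (mem_insert_self a s)), ?_⟩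
    intro b hb
    rcases mem_insert.1 hb with rfl | hb
    · exact le_max_right _ _
    · exact (h2 b hb).trans (le_max_left _ _)

/-- For fixed d only finitely many c and (u, v) occur, so the strict inequalities share one ratio
below 1. -/
lemma exists_isSiteRatio {d : ℕ} (hd : 2 ≤ d) : ∃ θ : ℝ, 0 < θ ∧ θ < 1 ∧ IsSiteRatio d θ := by
  have hg := bregmanWeight_pos d
  obtain ⟨θ₁, h10, h11, h1⟩ := exists_lt_one_forall_le (range d)
    (fun c : ℕ => (c : ℝ) * bregmanWeight (d - 1) ^ (c - 1) / bregmanWeight d ^ c) fun c hc => by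
      rw [div_lt_one (by positivity)]
      exact mul_bregmanWeight_pow_lt hd (mem_range.1 hc)
  obtain ⟨θ₂, h20, h21, h2⟩ := exists_lt_one_forall_le
    ((antidiagonal d).filter fun p => 0 < p.1 ∧ 0 < p.2)
    (fun p : ℕ × ℕ => bregmanWeight (d - 2) ^ p.1 * bregmanWeight (d - 1) ^ (2 * p.2) *
      ((p.1 / bregmanWeight (d - 2) + p.2 / bregmanWeight (d - 1)) ^ 2 -
        p.1 / bregmanWeight (d - 2) ^ 2) / bregmanWeight d ^ (p.1 + 2 * p.2)) fun p hp => by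
      simp only [mem_filter, HasAntidiagonal.mem_antidiagonal] at hp
      rw [div_lt_one (by positivity)]
      exact two_columns_bregmanWeight_lt hp.2.1 hp.2.2 hp.1
  refine ⟨max θ₁ θ₂, lt_max_of_lt_left h10, max_lt h11 h21, fun c hc => ?_,
    fun u v hu hv huv => ?_⟩
  · rw [← div_le_iff₀ (by positivity)]
    exact (h1 c (mem_range.2 hc)).trans (le_max_left _ _)
  · rw [← div_le_iff₀ (by positivity)]
    exact (h2 (u, v) (by simp [hu, hv, huv])).trans (le_max_right _ _)

variable {ι : Type*} [Fintype ι] [DecidableEq ι]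

/-- A site depends only on the rows meeting it, so it survives expansion at another site with which
it shares no row. -/
lemma IsSite.congr {d : ℕ} {S S' : ι → Finset ι} {Q : Finset ι} (h : IsSite d S Q)
    (hS : ∀ i, ∀ k ∈ Q, k ∈ S i ∨ k ∈ S' i → S' i = S i) : IsSite d S' Q := by
  have hmem : ∀ k ∈ Q, ∀ i, k ∈ S' i ↔ k ∈ S i := fun k hk i =>
    ⟨fun h' => hS i k hk (Or.inr h') ▸ h', fun h' => (hS i k hk (Or.inl h')).symm ▸ h'⟩
  rcases h with ⟨k, rfl, h1, h2⟩ | ⟨k, l, hkl, rfl, h1, h2, h3, h4, h5⟩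
  · have hk := hmem k (by simp)
    refine Or.inl ⟨k, rfl, fun i hi => ?_, by simpa only [hk] using h2⟩
    rw [hS i k (by simp) (Or.inr hi)]
    exact h1 i ((hk i).1 hi)
  · have hk := hmem k (by simp)
    have hl := hmem l (by simp)
    refine Or.inr ⟨k, l, hkl, rfl, fun i hi => ?_, by simpa only [hk] using h2,
      by simpa only [hl] using h3, by simpa only [hk, hl] using h4,
      by simpa only [hk, hl] using h5⟩
    have : S' i = S i := hi.elim (fun hi => hS i k (by simp) (Or.inr hi))
      (fun hi => hS i l (by simp) (Or.inr hi))
    rw [this]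
    exact h1 i (by rwa [← hk, ← hl])

/-- Choosing the entry (i, k) gives row i weight 1 and shortens the other rows through k to d - 1.
The constant C in `hF` carries the gains from other sites. -/
lemma card_matchings_le_of_short_column {d : ℕ} {θ : ℝ} (hθ : IsSiteRatio d θ)
    {S : ι → Finset ι} {k : ι} (hrow : ∀ i, k ∈ S i → (S i).card = d)
    (hcol : (univ.filter fun i => k ∈ S i).card < d) {C : ℝ} (hC : 0 ≤ C)
    (hF : ∀ F : ι → Finset ι, (∀ i, F i ⊆ S i) → (∀ i, Disjoint (S i) {k} → F i = S i) →
      ((matchings F).card : ℝ) ≤ C * ∏ i, bregmanWeight (F i).card) :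
    ((matchings S).card : ℝ) ≤ C * θ * ∏ i, bregmanWeight (S i).card := by
  set R := univ.filter fun i => k ∈ S i with hR
  have hmem : ∀ {i}, i ∈ R ↔ k ∈ S i := by simp [hR]
  have hsplit : ∀ f : ι → ℝ, ∏ i, f i = (∏ i ∈ R, f i) * ∏ i ∈ Rᶜ, f i :=
    fun f => (prod_mul_prod_compl R f).symm
  have hβ : ∀ i ∈ R, ∏ j, bregmanWeight (pin S i k j).card =
      bregmanWeight (d - 1) ^ (R.card - 1) * ∏ j ∈ Rᶜ, bregmanWeight (S j).card := by
    intro i hi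
    rw [hsplit, ← mul_prod_erase R _ hi, pin_self, card_singleton, bregmanWeight_one, one_mul]
    congr 1
    · rw [prod_congr rfl (g := fun _ => bregmanWeight (d - 1)), prod_const, card_erase_of_mem hi]
      intro j hj
      have hjk := hmem.1 (mem_of_mem_erase hj)
      rw [pin_of_ne S k (ne_of_mem_erase hj), card_erase_of_mem hjk, hrow j hjk]
    · refine prod_congr rfl fun j hj => ?_
      have hjR := mem_compl.1 hj
      rw [pin_of_ne S k (ne_of_mem_of_not_mem hi hjR).symm, erase_eq_of_notMem (fun h => hjR (hmem.2 h))]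
  have hrest : 0 ≤ ∏ j ∈ Rᶜ, bregmanWeight (S j).card :=
    prod_nonneg fun j _ => (bregmanWeight_pos _).le
  calc ((matchings S).card : ℝ) = ∑ i ∈ R, ((matchings (pin S i k)).card : ℝ) := by
        exact_mod_cast card_matchings_eq_sum_col S k
    _ ≤ ∑ i ∈ R, C * ∏ j, bregmanWeight (pin S i k j).card := by
        refine sum_le_sum fun i hi => hF _ (fun j => ?_) fun j hj => ?_
        · by_cases hji : j = i
          · rw [hji, pin_self, singleton_subset_iff]; exact hmem.1 hi
          · rw [pin_of_ne S k hji]; exact erase_subset _ _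
        · have hjk : k ∉ S j := disjoint_singleton_right.1 hj
          rw [pin_of_ne S k (ne_of_mem_of_not_mem hi (mt hmem.1 hjk)).symm, erase_eq_of_notMem hjk]
    _ = C * ((R.card * bregmanWeight (d - 1) ^ (R.card - 1)) *
        ∏ j ∈ Rᶜ, bregmanWeight (S j).card) := by
        rw [← mul_sum, sum_congr rfl hβ, sum_const, nsmul_eq_mul]; ring
    _ ≤ C * ((θ * bregmanWeight d ^ R.card) * ∏ j ∈ Rᶜ, bregmanWeight (S j).card) := by
        exact mul_le_mul_of_nonneg_left (mul_le_mul_of_nonneg_right (hθ.1 _ hcol) hrest) hC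
    _ = _ := by
        rw [hsplit fun j => bregmanWeight (S j).card,
          prod_congr (s₁ := R) rfl (g := fun _ => bregmanWeight d)
            (fun j hj => by rw [hrow j (hmem.1 hj)]), prod_const]
        ring

/-- Let x be the row weights after deleting both columns. Choosing (i, k) and (j, l) contributes the
factor 1/(x i · x j); since i ≠ j, the sum is the product of the sums of 1/x over the two columns,
minus the diagonal over common rows. -/
lemma card_matchings_le_of_two_columns {d : ℕ} {θ : ℝ} (hθ : IsSiteRatio d θ)
    {S : ι → Finset ι} {k l : ι} (hkl : k ≠ l)
    (hrow : ∀ i, k ∈ S i ∨ l ∈ S i → (S i).card = d)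
    (hk : (univ.filter fun i => k ∈ S i).card = d) (hl : (univ.filter fun i => l ∈ S i).card = d)
    (h0 : 0 < (univ.filter fun i => k ∈ S i ∧ l ∈ S i).card)
    (h1 : (univ.filter fun i => k ∈ S i ∧ l ∈ S i).card < d) {C : ℝ} (hC : 0 ≤ C)
    (hF : ∀ F : ι → Finset ι, (∀ i, F i ⊆ S i) → (∀ i, Disjoint (S i) {k, l} → F i = S i) →
      ((matchings F).card : ℝ) ≤ C * ∏ i, bregmanWeight (F i).card) :
    ((matchings S).card : ℝ) ≤ C * θ * ∏ i, bregmanWeight (S i).card := by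
  set K := univ.filter fun i => k ∈ S i with hK
  set L := univ.filter fun i => l ∈ S i with hL
  have hmK : ∀ {i}, i ∈ K ↔ k ∈ S i := by simp [hK]
  have hmL : ∀ {i}, i ∈ L ↔ l ∈ S i := by simp [hL]
  have hKL : (univ.filter fun i => k ∈ S i ∧ l ∈ S i) = K ∩ L := by
    ext i; simp [hmK, hmL]
  rw [hKL] at h0 h1
  set u := (K ∩ L).card with hu
  obtain ⟨v, hv⟩ : ∃ v, u + v = d := ⟨d - u, by omega⟩
  have hKd : (K \ L).card = v := by have := card_sdiff_add_card_inter K L; omega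
  have hLd : (L \ K).card = v := by
    have := card_sdiff_add_card_inter L K; rw [inter_comm] at this; omega
  let x : ι → ℝ := fun j => bregmanWeight (((S j).erase k).erase l).card
  have hx0 : ∀ j, 0 < x j := fun j => bregmanWeight_pos _
  have hxc : ∀ j ∈ K ∩ L, x j = bregmanWeight (d - 2) := by
    intro j hj
    obtain ⟨hj1, hj2⟩ := mem_inter.1 hj
    simp only [x]
    rw [card_erase_of_mem (mem_erase.2 ⟨hkl.symm, hmL.1 hj2⟩), card_erase_of_mem (hmK.1 hj1),
      hrow j (Or.inl (hmK.1 hj1))]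
    rfl
  have hxk : ∀ j ∈ K \ L, x j = bregmanWeight (d - 1) := by
    intro j hj
    obtain ⟨hj1, hj2⟩ := mem_sdiff.1 hj
    simp only [x]
    rw [erase_eq_of_notMem (fun h => hj2 (hmL.2 (mem_of_mem_erase h))),
      card_erase_of_mem (hmK.1 hj1), hrow j (Or.inl (hmK.1 hj1))]
  have hxl : ∀ j ∈ L \ K, x j = bregmanWeight (d - 1) := by
    intro j hj
    obtain ⟨hj1, hj2⟩ := mem_sdiff.1 hj
    simp only [x]
    rw [erase_eq_of_notMem (fun h => hj2 (hmK.2 h)),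
      card_erase_of_mem (hmL.1 hj1), hrow j (Or.inr (hmL.1 hj1))]
  have hprodZ : ∀ f : ι → ℝ, ∏ i ∈ K ∪ L, f i =
      (∏ i ∈ K ∩ L, f i) * (∏ i ∈ K \ L, f i) * ∏ i ∈ L \ K, f i := by
    intro f
    rw [← union_sdiff_self_eq_union, prod_union disjoint_sdiff,
      ← prod_inter_mul_prod_sdiff K L]
  have hX : ∏ i ∈ K ∪ L, x i = bregmanWeight (d - 2) ^ u * bregmanWeight (d - 1) ^ (2 * v) := by
    rw [hprodZ, prod_congr rfl hxc, prod_congr rfl hxk, prod_congr rfl hxl]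
    simp only [prod_const, ← hu, hKd, hLd]
    ring
  have hG : ∏ i ∈ K ∪ L, bregmanWeight (S i).card = bregmanWeight d ^ (u + 2 * v) := by
    rw [prod_congr rfl (g := fun _ => bregmanWeight d) (fun i hi => by
      rw [hrow i ((mem_union.1 hi).imp hmK.1 hmL.1)]), hprodZ]
    simp only [prod_const, ← hu, hKd, hLd]
    ring
  have hsumK : ∑ i ∈ K, (x i)⁻¹ = u / bregmanWeight (d - 2) + v / bregmanWeight (d - 1) := by
    rw [← sum_inter_add_sum_sdiff K L,
      sum_congr rfl fun j hj => by rw [hxc j hj],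
      sum_congr (s₁ := K \ L) rfl fun j hj => by rw [hxk j hj]]
    simp only [sum_const, ← hu, hKd, nsmul_eq_mul, div_eq_mul_inv]
  have hsumL : ∑ i ∈ L, (x i)⁻¹ = u / bregmanWeight (d - 2) + v / bregmanWeight (d - 1) := by
    rw [← sum_inter_add_sum_sdiff L K, inter_comm L K,
      sum_congr rfl fun j hj => by rw [hxc j hj],
      sum_congr (s₁ := L \ K) rfl fun j hj => by rw [hxl j hj]]
    simp only [sum_const, ← hu, hLd, nsmul_eq_mul, div_eq_mul_inv]
  have hsumKL : ∑ i ∈ K ∩ L, (x i)⁻¹ ^ 2 = u / bregmanWeight (d - 2) ^ 2 := by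
    rw [sum_congr rfl fun j hj => by rw [hxc j hj]]
    simp only [sum_const, ← hu, nsmul_eq_mul, div_eq_mul_inv, inv_pow]
  have hdouble : ∑ i ∈ K, ∑ j ∈ L.erase i, (x i)⁻¹ * (x j)⁻¹ =
      (u / bregmanWeight (d - 2) + v / bregmanWeight (d - 1)) ^ 2 -
        u / bregmanWeight (d - 2) ^ 2 := by
    have hinner : ∀ i ∈ K, ∑ j ∈ L.erase i, (x i)⁻¹ * (x j)⁻¹ =
        (x i)⁻¹ * ∑ j ∈ L, (x j)⁻¹ - if i ∈ L then (x i)⁻¹ ^ 2 else 0 := by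
      intro i _
      rw [← mul_sum]
      split_ifs with hi
      · rw [← add_sum_erase L _ hi]; ring
      · rw [erase_eq_of_notMem hi, sub_zero]
    rw [sum_congr rfl hinner, sum_sub_distrib, ← sum_mul, hsumK, hsumL, sum_ite_mem, hsumKL]
    ring
  have hpin : ∀ i j, j ∉ ({i} : Finset ι) → ∀ t, pin (pin S i k) j l t =
      if t = j then {l} else if t = i then {k} else ((S t).erase k).erase l := by
    intro i j hij t
    by_cases htj : t = j
    · rw [htj, pin_self, if_pos rfl]
    · rw [pin_of_ne _ _ htj, if_neg htj]
      by_cases hti : t = i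
      · rw [hti, pin_self, if_pos rfl, erase_eq_of_notMem (by simpa using hkl.symm)]
      · rw [pin_of_ne _ _ hti, if_neg hti]
  have hrestpos : 0 ≤ ∏ t ∈ (K ∪ L)ᶜ, bregmanWeight (S t).card :=
    prod_nonneg fun j _ => (bregmanWeight_pos _).le
  have hβ : ∀ i ∈ K, ∀ j ∈ L.erase i, ∏ t, bregmanWeight (pin (pin S i k) j l t).card =
      (∏ t ∈ K ∪ L, x t) * ((x i)⁻¹ * (x j)⁻¹) *
        ∏ t ∈ (K ∪ L)ᶜ, bregmanWeight (S t).card := by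
    intro i hi j hj
    have hji := ne_of_mem_erase hj
    have hiZ : i ∈ K ∪ L := mem_union_left _ hi
    have hjZ : j ∈ K ∪ L := mem_union_right _ (mem_of_mem_erase hj)
    have hjZ' : j ∈ (K ∪ L).erase i := mem_erase.2 ⟨hji, hjZ⟩
    have hpin' := hpin i j (by simpa using hji)
    rw [← prod_mul_prod_compl (K ∪ L)]
    congr 1
    · rw [← mul_prod_erase _ _ hiZ, ← mul_prod_erase _ _ hjZ', ← mul_prod_erase _ x hiZ,
        ← mul_prod_erase _ x hjZ', hpin', hpin', if_neg hji.symm, if_pos rfl, if_pos rfl,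
        card_singleton, card_singleton, bregmanWeight_one,
        prod_congr rfl (g := x) (fun t ht => by
          rw [hpin', if_neg (ne_of_mem_erase ht),
            if_neg (ne_of_mem_erase (mem_of_mem_erase ht))])]
      have := (hx0 i).ne'
      have := (hx0 j).ne'
      field_simp
    · refine prod_congr rfl fun t ht => ?_
      have htZ := mem_compl.1 ht
      rw [hpin', if_neg (ne_of_mem_of_not_mem hjZ htZ).symm, if_neg (ne_of_mem_of_not_mem hiZ htZ).symm,
        erase_eq_of_notMem (s := S t) (fun h => htZ (mem_union_left _ (hmK.2 h))),
        erase_eq_of_notMem (fun h => htZ (mem_union_right _ (hmL.2 h)))]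
  have hexp : ((matchings S).card : ℝ) =
      ∑ i ∈ K, ∑ j ∈ L.erase i, ((matchings (pin (pin S i k) j l)).card : ℝ) := by
    rw [card_matchings_eq_sum_col S k, Nat.cast_sum]
    refine sum_congr rfl fun i hi => ?_
    rw [card_matchings_eq_sum_col (pin S i k) l, Nat.cast_sum]
    refine sum_congr ?_ fun _ _ => rfl
    ext j
    rw [mem_filter, mem_erase, hmL]
    by_cases hji : j = i
    · simp [hji, pin_self, hkl.symm]
    · simp [hji, pin_of_ne, hkl.symm]
  rw [hexp]
  calc ∑ i ∈ K, ∑ j ∈ L.erase i, ((matchings (pin (pin S i k) j l)).card : ℝ)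
      ≤ ∑ i ∈ K, ∑ j ∈ L.erase i,
        C * ∏ t, bregmanWeight (pin (pin S i k) j l t).card := by
        refine sum_le_sum fun i hi => sum_le_sum fun j hj => hF _ (fun t => ?_) fun t ht => ?_
        · rw [hpin i j (by simpa using ne_of_mem_erase hj)]
          split_ifs with h h'
          · rw [h, singleton_subset_iff]; exact hmL.1 (mem_of_mem_erase hj)
          · rw [h', singleton_subset_iff]; exact hmK.1 hi
          · exact (erase_subset _ _).trans (erase_subset _ _)
        · have htk : k ∉ S t := fun h => disjoint_left.1 ht h (by simp)
          have htl : l ∉ S t := fun h => disjoint_left.1 ht h (by simp)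
          rw [hpin i j (by simpa using ne_of_mem_erase hj),
            if_neg (ne_of_mem_of_not_mem (mem_of_mem_erase hj) (mt hmL.1 htl)).symm,
            if_neg (ne_of_mem_of_not_mem hi (mt hmK.1 htk)).symm, erase_eq_of_notMem (s := S t) htk,
            erase_eq_of_notMem htl]
    _ = C * ((∏ t ∈ K ∪ L, x t) * (∑ i ∈ K, ∑ j ∈ L.erase i, (x i)⁻¹ * (x j)⁻¹) *
        ∏ t ∈ (K ∪ L)ᶜ, bregmanWeight (S t).card) := by
        rw [sum_congr rfl fun i hi => sum_congr rfl fun j hj => by rw [hβ i hi j hj]]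
        simp only [← mul_sum, ← sum_mul]
    _ ≤ C * (θ * bregmanWeight d ^ (u + 2 * v) *
        ∏ t ∈ (K ∪ L)ᶜ, bregmanWeight (S t).card) := by
        rw [hX, hdouble]
        exact mul_le_mul_of_nonneg_left
          (mul_le_mul_of_nonneg_right (hθ.2 u v h0 (by omega) hv) hrestpos) hC
    _ = _ := by
        rw [← hG, ← prod_mul_prod_compl (K ∪ L) fun i => bregmanWeight (S i).card]
        ring

/-- Expanding the permanent at a site improves any bound relative to Bregman's by `θ`. -/
lemma IsSite.card_matchings_le {d : ℕ} {θ : ℝ} (hθ : IsSiteRatio d θ) {S : ι → Finset ι}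
    {Q : Finset ι} (hQ : IsSite d S Q) {C : ℝ} (hC : 0 ≤ C)
    (hF : ∀ F : ι → Finset ι, (∀ i, F i ⊆ S i) → (∀ i, Disjoint (S i) Q → F i = S i) →
      ((matchings F).card : ℝ) ≤ C * ∏ i, bregmanWeight (F i).card) :
    ((matchings S).card : ℝ) ≤ C * θ * ∏ i, bregmanWeight (S i).card := by
  rcases hQ with ⟨k, rfl, h1, h2⟩ | ⟨k, l, hkl, rfl, h1, h2, h3, h4, h5⟩
  · exact card_matchings_le_of_short_column hθ h1 h2 hC hF
  · exact card_matchings_le_of_two_columns hθ hkl h1 h2 h3 h4 h5 hC hF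

/-- Sites no two of which are met by a common row improve Bregman's bound independently. -/
theorem card_matchings_le_pow_mul_prod {κ : Type*} {d : ℕ} {θ : ℝ} (hθ0 : 0 ≤ θ)
    (hθ : IsSiteRatio d θ) (Q : κ → Finset ι) (K : Finset κ) (S : ι → Finset ι)
    (hsite : ∀ a ∈ K, IsSite d S (Q a))
    (hsep : ∀ a ∈ K, ∀ b ∈ K, a ≠ b → ∀ i, Disjoint (S i) (Q a) ∨ Disjoint (S i) (Q b)) :
    ((matchings S).card : ℝ) ≤ θ ^ K.card * ∏ i, bregmanWeight (S i).card := by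
  classical
  induction K using Finset.induction_on generalizing S with
  | empty => simpa using card_matchings_le_prod_bregmanWeight S
  | insert a K ha ih =>
    rw [card_insert_of_notMem ha, pow_succ]
    refine (hsite a (mem_insert_self a K)).card_matchings_le hθ (by positivity) ?_
    intro F hFS hF
    refine ih F (fun b hb => (hsite b (mem_insert_of_mem hb)).congr fun i k hk hki => hF i ?_)
      fun b hb c hc hbc i => ?_
    · have hki' : k ∈ S i := hki.elim id fun h => hFS i h
      refine (hsep a (mem_insert_self a K) b (mem_insert_of_mem hb) ?_ i).resolve_right ?_
      · rintro rfl; exact ha hb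
      · exact fun h => disjoint_left.1 h hki' hk
    · exact (hsep b (mem_insert_of_mem hb) c (mem_insert_of_mem hc) hbc i).imp
        (fun h => h.mono_left (hFS i)) (fun h => h.mono_left (hFS i))

end Sites

/-! ### Finding sites in matrices of consecutive ones -/

/-- The supports of rows consisting of `d` consecutive ones, the leftmost in column `x i`. -/
def blockRows (n d : ℕ) (x : Fin n → ℕ) (i : Fin n) : Finset (Fin n) :=
  Finset.univ.filter fun j => x i ≤ (j : ℕ) ∧ (j : ℕ) < x i + d

section Blocks

open Finset

variable {n d : ℕ} {x : Fin n → ℕ}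

lemma mem_blockRows {i j : Fin n} :
    j ∈ blockRows n d x i ↔ x i ≤ (j : ℕ) ∧ (j : ℕ) < x i + d := by
  simp [blockRows]

lemma card_blockRows {i : Fin n} (hx : x i + d ≤ n) : (blockRows n d x i).card = d := by
  have h : (blockRows n d x i).map Fin.valEmbedding = Finset.Ico (x i) (x i + d) := by
    ext j
    simp only [mem_map, mem_blockRows, Fin.valEmbedding_apply, Finset.mem_Ico]
    constructor
    · rintro ⟨k, hk, rfl⟩; exact hk
    · intro hj; exact ⟨⟨j, by omega⟩, hj, rfl⟩
  rw [← card_map Fin.valEmbedding, h, Nat.card_Ico, Nat.add_sub_cancel_left]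

lemma permanent_eq_card_matchings {B : Matrix (Fin n) (Fin n) ℕ}
    (hB : ∀ i j : Fin n, B i j = if x i ≤ (j : ℕ) ∧ (j : ℕ) < x i + d then 1 else 0) :
    B.permanent = (matchings (blockRows n d x)).card := by
  -- The permanent multiplies entries `B (σ i) i`, whereas `matchings` puts σ i in row i.
  rw [← Matrix.permanent_transpose, Matrix.permanent, matchings, card_filter]
  refine sum_congr rfl fun σ _ => ?_
  simp only [Matrix.transpose_apply, hB, mem_blockRows]
  rw [prod_ite_zero]
  simp

/-- The excluded submatrix enters only here: d rows with the same block would form it on the columns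
of that block. -/
lemma card_filter_eq_lt_of_not_containsOnes {B : Matrix (Fin n) (Fin n) ℕ} (hd : 0 < d)
    (hx : ∀ i, x i + d ≤ n)
    (hB : ∀ i j : Fin n, B i j = if x i ≤ (j : ℕ) ∧ (j : ℕ) < x i + d then 1 else 0)
    (hBc : ¬ ContainsOnes d B) (y : ℕ) : (univ.filter fun i => x i = y).card < d := by
  by_contra! h
  obtain ⟨i₀, hi₀⟩ := card_pos.1 (hd.trans_le h)
  have hy : y + d ≤ n := (mem_filter.1 hi₀).2 ▸ hx i₀
  obtain ⟨r⟩ : Nonempty (Fin d ↪ {i // i ∈ univ.filter fun i => x i = y}) :=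
    Function.Embedding.nonempty_of_card_le (by simpa only [Fintype.card_fin, Fintype.card_coe])
  refine hBc ⟨r.trans (Function.Embedding.subtype _),
    ⟨fun j => ⟨y + j, by omega⟩, fun i j hij => Fin.ext (by simpa using hij)⟩, ?_⟩
  ext i j
  have : x (r i) = y := (mem_filter.1 (r i).2).2
  change B (r i) _ = 1
  rw [hB, if_pos]
  change x (r i) ≤ y + j ∧ y + j < x (r i) + d
  omega

/-- Columns of sum above `d` are compensated by columns of sum below `d`. -/
lemma card_filter_lt_card_column_le (hx : ∀ i, x i + d ≤ n) :
    (univ.filter fun k => d < (univ.filter fun i => k ∈ blockRows n d x i).card).card ≤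
      d * (univ.filter fun k => (univ.filter fun i => k ∈ blockRows n d x i).card < d).card := by
  set c : Fin n → ℕ := fun k => (univ.filter fun i => k ∈ blockRows n d x i).card with hc
  have hsum : ∑ k, c k = n * d := by
    calc ∑ k, c k = ∑ i, (blockRows n d x i).card := by
          simp only [hc, card_filter]
          rw [sum_comm]
          refine sum_congr rfl fun i _ => ?_
          rw [← card_filter]
          congr 1
          ext k
          simp
      _ = n * d := by simp [card_blockRows (hx _)]
  have hsum' : ∑ k, ((c k : ℤ) - d) = 0 := by
    rw [sum_sub_distrib]
    have : ∑ k, (c k : ℤ) = n * d := by exact_mod_cast hsum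
    simp [this]
  -- A long column exceeds the average d by at least 1; a short one falls below it by at most d.
  have hle : ∑ k : Fin n, ((if d < c k then (1 : ℤ) else 0) - d * if c k < d then (1 : ℤ) else 0) ≤
      ∑ k, ((c k : ℤ) - d) := by
    refine sum_le_sum fun k _ => ?_
    split_ifs <;> omega
  rw [hsum', sum_sub_distrib, ← mul_sum, sum_boole, sum_boole] at hle
  have : ((univ.filter fun k => d < c k).card : ℤ) ≤ d * (univ.filter fun k => c k < d).card := by
    linarith
  exact_mod_cast this

/-- Among `d + 1` consecutive columns there is one of sum above `d`, or one where a site starts. -/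
lemma exists_site_or_long_column (hd : 0 < d) (hx : ∀ i, x i + d ≤ n)
    (hmult : ∀ y, (univ.filter fun i => x i = y).card < d) {w : ℕ} (hw : w + d < n) :
    ∃ k : Fin n, w ≤ k ∧ (k : ℕ) ≤ w + d ∧
      (d < (univ.filter fun i => k ∈ blockRows n d x i).card ∨
        ∃ Q, IsSite d (blockRows n d x) Q ∧ ∀ j ∈ Q, (j : ℕ) = k ∨ (j : ℕ) = k + 1) := by
  by_contra! hcon
  set c : Fin n → ℕ := fun k => (univ.filter fun i => k ∈ blockRows n d x i).card with hc
  have hcd : ∀ k : Fin n, w ≤ k → (k : ℕ) ≤ w + d → c k = d := by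
    intro k h1 h2
    refine le_antisymm (hcon k h1 h2).1 ?_
    by_contra! hlt
    obtain ⟨j, hj, hj'⟩ := (hcon k h1 h2).2 {k}
      (Or.inl ⟨k, rfl, fun i _ => card_blockRows (hx i), hlt⟩)
    exact hj'.1 (by rw [mem_singleton.1 hj])
  -- If some rows start at l, they are fewer than d, so columns l - 1 and l, both of sum d, overlap
  -- partially and form a site.
  have hzero : ∀ k : Fin n, w < k → (k : ℕ) ≤ w + d → ∀ i, x i ≠ k := by
    intro l h1 h2 i hi
    obtain ⟨k, hk⟩ : ∃ k : Fin n, (k : ℕ) + 1 = l := ⟨⟨l - 1, by omega⟩, by simp; omega⟩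
    have hkl : k ≠ l := fun h => by rw [h] at hk; omega
    have hsplit : (univ.filter fun i => k ∈ blockRows n d x i ∧ l ∈ blockRows n d x i).card +
        (univ.filter fun i => x i = l).card = c l := by
      rw [← card_union_of_disjoint]
      · simp only [hc]
        congr 1
        ext i
        simp only [mem_union, mem_filter, mem_univ, true_and, mem_blockRows]
        omega
      · rw [disjoint_filter]
        intro i _ h3 h4
        simp only [mem_blockRows] at h3
        omega
    have hpos : 0 < (univ.filter fun i => x i = l).card :=
      card_pos.2 ⟨i, mem_filter.2 ⟨mem_univ _, hi⟩⟩
    have hlt := hmult l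
    have hcl := hcd l h1.le h2
    obtain ⟨j, hj, hj'⟩ := (hcon k (by omega) (by omega)).2 {k, l}
      (Or.inr ⟨k, l, hkl, rfl, fun i _ => card_blockRows (hx i), hcd k (by omega) (by omega), hcl,
        by omega, by omega⟩)
    rcases mem_insert.1 hj with rfl | hj
    · exact hj'.1 rfl
    · rw [mem_singleton.1 hj] at hj'
      exact hj'.2 hk.symm
  -- Column w + d meets some row, whose block of length d must start in w + 1, …, w + d.
  have hlast := hcd ⟨w + d, hw⟩ (by simp) le_rfl
  obtain ⟨i, hi⟩ := card_pos.1 (hlast.symm ▸ hd : 0 < c ⟨w + d, hw⟩)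
  have hi' := mem_blockRows.1 (mem_filter.1 hi).2
  simp only at hi'
  exact hzero ⟨x i, by omega⟩ (by simp; omega) hi'.1 i rfl

/-- A large matrix with blocks of `d` consecutive ones as rows, fewer than `d` of them equal, has
many sites at mutual distance. -/
lemma exists_separated_sites (hd : 0 < d) (hx : ∀ i, x i + d ≤ n)
    (hmult : ∀ y, (univ.filter fun i => x i = y).card < d) {N : ℕ} (hn : (d + 1) ^ 3 * N ≤ n) :
    ∃ (K : Finset (Fin n)) (Q : Fin n → Finset (Fin n)), N ≤ K.card ∧
      (∀ a ∈ K, IsSite d (blockRows n d x) (Q a)) ∧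
      ∀ a ∈ K, ∀ b ∈ K, a ≠ b → ∀ i, Disjoint (blockRows n d x i) (Q a) ∨
        Disjoint (blockRows n d x i) (Q b) := by
  classical
  set c : Fin n → ℕ := fun k => (univ.filter fun i => k ∈ blockRows n d x i).card with hc
  let K₀ : Finset (Fin n) := univ.filter fun k =>
    ∃ Q, IsSite d (blockRows n d x) Q ∧ ∀ j ∈ Q, (j : ℕ) = k ∨ (j : ℕ) = k + 1
  have hshort : (univ.filter fun k => c k < d).card ≤ K₀.card := by
    refine card_le_card fun k hk => mem_filter.2 ⟨mem_univ _, {k}, Or.inl ⟨k, rfl,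
      fun i _ => card_blockRows (hx i), (mem_filter.1 hk).2⟩, fun j hj => Or.inl ?_⟩
    rw [mem_singleton.1 hj]
  -- Of the three factors d + 1 in the bound on n, one pays for these disjoint windows, one for the
  -- long columns, and one for the choice of a residue class.
  have hwin : ∀ j ∈ range ((d + 1) ^ 2 * N), ∃ k ∈ (univ.filter fun k => d < c k) ∪ K₀,
      (k : ℕ) / (d + 1) = j := by
    intro j hj
    have hj' : (j + 1) * (d + 1) ≤ n := by
      calc (j + 1) * (d + 1) ≤ (d + 1) ^ 2 * N * (d + 1) := by
            gcongr; exact mem_range.1 hj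
        _ = (d + 1) ^ 3 * N := by ring
        _ ≤ n := hn
    have hw : j * (d + 1) + d < n := by nlinarith
    obtain ⟨k, h1, h2, h3⟩ := exists_site_or_long_column hd hx hmult hw
    refine ⟨k, ?_, ?_⟩
    · rcases h3 with h3 | h3
      · exact mem_union_left _ (mem_filter.2 ⟨mem_univ _, h3⟩)
      · exact mem_union_right _ (mem_filter.2 ⟨mem_univ _, h3⟩)
    · exact Nat.div_eq_of_lt_le h1 (by nlinarith)
  have hcount : (d + 1) ^ 2 * N ≤ (d + 1) * K₀.card := by
    calc (d + 1) ^ 2 * N = (range ((d + 1) ^ 2 * N)).card := (card_range _).symm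
      _ ≤ ((univ.filter fun k => d < c k) ∪ K₀).card := by
          refine (card_le_card fun j hj => ?_).trans
            (card_image_le (f := fun k : Fin n => (k : ℕ) / (d + 1)))
          exact mem_image.2 (hwin j hj)
      _ ≤ (univ.filter fun k => d < c k).card + K₀.card := card_union_le _ _
      _ ≤ d * (univ.filter fun k => c k < d).card + K₀.card := by
          gcongr; exact card_filter_lt_card_column_le hx
      _ ≤ d * K₀.card + K₀.card := by gcongr
      _ = (d + 1) * K₀.card := by ring
  have hcount' : (d + 1) * N ≤ K₀.card := by
    refine le_of_mul_le_mul_left ?_ (Nat.succ_pos d)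
    calc (d + 1) * ((d + 1) * N) = (d + 1) ^ 2 * N := by ring
      _ ≤ _ := hcount
  obtain ⟨r, -, hr⟩ := exists_le_card_fiber_of_mul_le_card_of_maps_to (s := K₀)
    (t := range (d + 1)) (f := fun k : Fin n => (k : ℕ) % (d + 1)) (n := N)
    (fun k _ => mem_range.2 (Nat.mod_lt _ (Nat.succ_pos d))) (by simp) (by rwa [card_range])
  have hQ : ∀ k ∈ K₀, ∃ Q, IsSite d (blockRows n d x) Q ∧
      ∀ j ∈ Q, (j : ℕ) = k ∨ (j : ℕ) = k + 1 := fun k hk => (mem_filter.1 hk).2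
  choose! Q hQ1 hQ2 using hQ
  refine ⟨_, Q, hr, fun a ha => hQ1 a (mem_filter.1 ha).1, fun a ha b hb hab i => ?_⟩
  obtain ⟨ha0, ha1⟩ := mem_filter.1 ha
  obtain ⟨hb0, hb1⟩ := mem_filter.1 hb
  by_contra! hdis
  obtain ⟨j, hj1, hj2⟩ := not_disjoint_iff.1 hdis.1
  obtain ⟨l, hl1, hl2⟩ := not_disjoint_iff.1 hdis.2
  have hj := hQ2 a ha0 j hj2
  have hl := hQ2 b hb0 l hl2
  rw [mem_blockRows] at hj1 hl1
  -- Distinct starts in one class differ by at least d + 1. A site reaches at most one column past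
  -- its start, so columns of two sites are at least d apart, too far for one block.
  have hmod : (a : ℕ) ≡ b [MOD d + 1] := ha1.trans hb1.symm
  have hval : (a : ℕ) ≠ b := fun h => hab (Fin.ext h)
  rcases Nat.lt_or_gt_of_ne hval with h | h
  · have := Nat.le_of_dvd (by omega) ((Nat.modEq_iff_dvd' h.le).1 hmod)
    omega
  · have := Nat.le_of_dvd (by omega) ((Nat.modEq_iff_dvd' h.le).1 hmod.symm)
    omega

end Blocks

/-! ### Lower bounds for permanents of direct sums -/

section DirectSums

open Finset

lemma sum_comp_le_sum_of_injective {α β : Type*} [Fintype α] [Fintype β] {f : α → β}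
    (hf : Function.Injective f) (g : β → ℕ) : ∑ a, g (f a) ≤ ∑ b, g b := by
  refine (sum_map univ ⟨f, hf⟩ g).symm.trans_le ?_
  exact sum_le_sum_of_subset (subset_univ _)

lemma permanent_reindex_self {α β R : Type*} [Fintype α] [DecidableEq α] [Fintype β]
    [DecidableEq β] [CommSemiring R] (e : α ≃ β) (M : Matrix α α R) :
    (Matrix.reindex e e M).permanent = M.permanent := by
  refine Fintype.sum_equiv e.symm.permCongr _ _ fun σ => ?_
  exact Fintype.prod_equiv e.symm _ _ fun i => by simp [Equiv.permCongr_apply]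

/-- Pairs of permutations inject into permutations of the sum, and the remaining terms are
nonnegative. -/
lemma permanent_mul_permanent_le_directSum {m n : ℕ} (A : Matrix (Fin m) (Fin m) ℕ)
    (B : Matrix (Fin n) (Fin n) ℕ) :
    A.permanent * B.permanent ≤ (directSum A B).permanent := by
  rw [directSum, permanent_reindex_self, Matrix.permanent, Matrix.permanent, sum_mul_sum,
    ← sum_product', univ_product_univ, Matrix.permanent]
  refine le_trans (le_of_eq ?_)
    (sum_comp_le_sum_of_injective Equiv.Perm.sumCongrHom_injective _)
  refine sum_congr rfl fun p _ => ?_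
  simp [Fintype.prod_sum_type]

lemma factorial_pow_le_permanent_copies (d t : ℕ) :
    d.factorial ^ t ≤ (copies t (onesMat d)).permanent := by
  rw [copies, permanent_reindex_self, Matrix.permanent]
  have hinj : Function.Injective
      (Equiv.prodCongrLeft : (Fin t → Equiv.Perm (Fin d)) → Equiv.Perm (Fin d × Fin t)) := by
    intro F G h
    ext k i
    have := DFunLike.congr_fun h (i, k)
    simp only [Equiv.prodCongrLeft_apply, Prod.mk.injEq] at this
    rw [this.1]
  refine le_trans (le_of_eq ?_) (sum_comp_le_sum_of_injective hinj _)
  simp [Matrix.blockDiagonal_apply, onesMat, Fintype.card_perm]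

end DirectSums

/-! ### Comparison of the two permanents -/

theorem theorem3p5 (a d : ℕ) (A : Matrix (Fin a) (Fin a) ℕ) (hA : A ∈ Gam a d)
    (hper : 0 < A.permanent) :
    ∃ m : ℕ, ∀ t : ℕ, m < a + t * d →
      ∀ B : Matrix (Fin (a + t * d)) (Fin (a + t * d)) ℕ, B ∈ Gam (a + t * d) d →
        ¬ ContainsOnes d B →
          B.permanent < (directSum A (copies t (onesMat d))).permanent := by
  rcases Nat.eq_zero_or_pos d with rfl | hd
  -- For d = 0 the order is always a, so the claim is vacuous beyond a.
  · exact ⟨a, fun t ht => absurd ht (by simp)⟩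
  rcases Nat.lt_or_ge d 2 with hd1 | hd2
  -- For d = 1 no B qualifies: any row already contains the submatrix.
  · obtain rfl : d = 1 := by omega
    refine ⟨0, fun t ht B hB hBc => ?_⟩
    choose x hx hBx using hB
    have := card_filter_eq_lt_of_not_containsOnes one_pos hx hBx hBc (x ⟨0, ht⟩)
    rw [Nat.lt_one_iff, Finset.card_eq_zero, Finset.filter_eq_empty_iff] at this
    exact (this (Finset.mem_univ (⟨0, ht⟩ : Fin (a + t * 1))) rfl).elim
  obtain ⟨θ, hθ0, hθ1, hθ⟩ := exists_isSiteRatio hd2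
  have hg := bregmanWeight_pos d
  -- N sites offset the a rows that the t all-ones blocks do not account for.
  obtain ⟨N, hN⟩ := exists_pow_lt_of_lt_one
    (show 0 < (bregmanWeight d ^ a)⁻¹ by positivity) hθ1
  refine ⟨(d + 1) ^ 3 * N, fun t ht B hB hBc => ?_⟩
  choose x hx hBx using hB
  have hmult := card_filter_eq_lt_of_not_containsOnes hd hx hBx hBc
  obtain ⟨K, Q, hK, hsite, hsep⟩ := exists_separated_sites hd hx hmult ht.le
  have hbound := card_matchings_le_pow_mul_prod hθ0.le hθ Q K _ hsite hsep
  simp only [card_blockRows (hx _), Finset.prod_const, Finset.card_univ,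
    Fintype.card_fin] at hbound
  have hlt : (B.permanent : ℝ) < (d.factorial : ℝ) ^ t := by
    rw [permanent_eq_card_matchings hBx]
    calc _ ≤ θ ^ K.card * bregmanWeight d ^ (a + t * d) := hbound
      _ ≤ θ ^ N * bregmanWeight d ^ (a + t * d) := by
          gcongr ?_ * _
          exact pow_le_pow_of_le_one hθ0.le hθ1.le hK
      _ < (bregmanWeight d ^ a)⁻¹ * bregmanWeight d ^ (a + t * d) := by gcongr
      _ = (d.factorial : ℝ) ^ t := by
          rw [pow_add, inv_mul_cancel_left₀ (by positivity), mul_comm t d, pow_mul,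
            bregmanWeight_pow hd.ne']
  calc B.permanent < d.factorial ^ t := by exact_mod_cast hlt
    _ ≤ 1 * (copies t (onesMat d)).permanent := by
        rw [one_mul]; exact factorial_pow_le_permanent_copies d t
    _ ≤ A.permanent * (copies t (onesMat d)).permanent := Nat.mul_le_mul_right _ hper
    _ ≤ _ := permanent_mul_permanent_le_directSum A _
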